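/- Let $(M,g)$ be an oriented pseudo-Riemannian spin manifold of dimension $2n$ with Levi-Civita connection $\nabla$, complex spinor bundle $S$ (rank $2^n$), Clifford multiplication $\gamma$, $\gamma(X)\gamma(Y)+\gamma(Y)\gamma(X)=-2g(X,Y)$, and chirality operator $\gamma^*$ ($\gamma^*=\gamma^1\cdots\gamma^{2n}$ or $i\,\gamma^1\cdots\gamma^{2n}$ in oriented orthonormal frames, so that $(\gamma^*)^2=1$). Let $C$ be a charge conjugation on $S$, that is, a nondegenerate complex bilinear form, parallel for the Levi-Civita connection, such that $C(\phi,\psi)$ and $C(\phi,\gamma(X)\psi)$ each have a definite symmetry $\Delta_0,\Delta_1\in\{\pm1\}$ under exchange of $\phi$ and $\psi$. Let $$\tau_0=\begin{pmatrix}1&0\\0&1\end{pmatrix},\quad \tau_1=\begin{pmatrix}0&1\\1&0\end{pmatrix},\quad \tau_2=\begin{pmatrix}0&1\\-1&0\end{pmatrix},\quad \tau_3=\begin{pmatrix}1&0\\0&-1\end{pmatrix},$$ and equip the twisted spinor bundle $S\oplus S=S\otimes\mathbb C^2$ with the form $\mathbf C=C\otimes\tau_k$ for some $k\in\{0,1,2,3\}$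 (for $k=0$ it is $C\oplus C$), with Clifford multiplication $\gamma\otimes\mathbb 1$, and with the connection $\nabla$ induced by Levi-Civita. For a connection $D$ on $S\oplus S$ let $D^C$ be the connection determined by $(D\otimes\mathbb 1+\mathbb 1\otimes D^C)\mathbf C=0$, i.e. $X(\mathbf C(\phi,\psi))=\mathbf C(D_X\phi,\psi)+\mathbf C(\phi,D^C_X\psi)$; put $(\hat D_Z\gamma)(X)\xi=D_Z(\gamma(X)\xi)-\gamma(\nabla_ZX)\xi-\gamma(X)D^C_Z\xi$, and let $\mathcal T^D(X,Y)=(\hat D_X\gamma)(Y)-(\hat D_Y\gamma)(X)$ be the torsion of $D$. The connection $D$ is called admissible if $(\hat D_X\gamma)(Y)$ is skew symmetric in $X,Y$. For $i,j\in\{0,1,2,3\}$ and a sign $w\in\{\pm1\}$ put $P_w=\mathbb 1\otimes\tau_i+w\,\gamma^*\otimes\tau_j$. An $\mathrm{End}(S\oplus S)$-valued $1$-form (or $2$-form) is called proportional to $P_w$ if it equals $(B\otimes\mathbb 1)P_w$ for some $\mathrm{End}(S)$-valued $1$-form (or $2$-form) $B$. Let $D$ be a connection on $S\oplus S$ with a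 contribution $A$, an $\mathrm{End}(S\oplus S)$-valued $1$-form, which is proportional to $P_w$ and admissible, in the sense that $\nabla+A$ is an admissible connection. Then the parts of $D^C$ and of the torsion of $D$ which are associated with $A$, namely $$D^C-(D-A)^C\qquad\text{and}\qquad \mathcal T^{D}-\mathcal T^{D-A},$$ are proportional to the opposite projection $P_{-w}=\mathbb 1\otimes\tau_i-w\,\gamma^*\otimes\tau_j$. -/

import Mathlib

open Bundle
open scoped Manifold ContDiff

noncomputable section

namespace SpinTorsion

/-! ### Twisting by `2 × 2` matrices -/

/-- The modified Pauli matrices `τ₀, τ₁, τ₂, τ₃`. -/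
def tau : Fin 4 → Matrix (Fin 2) (Fin 2) ℂ :=
  ![!![1, 0; 0, 1], !![0, 1; 1, 0], !![0, 1; -1, 0], !![1, 0; 0, -1]]

/-- The endomorphism `f ⊗ m` of `V ⊕ V = V ⊗ ℂ²`. -/
def twist {V : Type*} [AddCommGroup V] [Module ℂ V] (f : Module.End ℂ V)
    (m : Matrix (Fin 2) (Fin 2) ℂ) : Module.End ℂ (V × V) :=
  LinearMap.prod
    (m 0 0 • (f ∘ₗ LinearMap.fst ℂ V V) + m 0 1 • (f ∘ₗ LinearMap.snd ℂ V V))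
    (m 1 0 • (f ∘ₗ LinearMap.fst ℂ V V) + m 1 1 • (f ∘ₗ LinearMap.snd ℂ V V))

section Geometry

variable {E : Type*} [NormedAddCommGroup E] [NormedSpace ℝ E] [FiniteDimensional ℝ E]
  {M : Type*} [TopologicalSpace M] [ChartedSpace E M] [IsManifold 𝓘(ℝ, E) ∞ M]

/-- Differentiability in a point of a section of a vector bundle `V` with fibre `G`. -/
def SectionDiffAt (E : Type*) [NormedAddCommGroup E] [NormedSpace ℝ E]
    {M : Type*} [TopologicalSpace M] [ChartedSpace E M]
    (G : Type*) [NormedAddCommGroup G] [NormedSpace ℝ G]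
    {V : M → Type*} [TopologicalSpace (TotalSpace G V)] [∀ x, TopologicalSpace (V x)]
    [FiberBundle G V] (σ : Π x : M, V x) (x : M) : Prop :=
  MDifferentiableAt 𝓘(ℝ, E) (𝓘(ℝ, E).prod 𝓘(ℝ, G)) (fun p ↦ TotalSpace.mk' G p (σ p)) x

/-! ### The base manifold -/

variable (E M) in
/-- A smooth pseudo-Riemannian metric, of arbitrary signature. -/
structure PseudoRiemannianMetric where
  val (x : M) : TangentSpace 𝓘(ℝ, E) x →L[ℝ] TangentSpace 𝓘(ℝ, E) x →L[ℝ] ℝ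
  symm (x : M) (v w : TangentSpace 𝓘(ℝ, E) x) : val x v w = val x w v
  nondegenerate (x : M) (v : TangentSpace 𝓘(ℝ, E) x) (hv : ∀ w, val x v w = 0) : v = 0
  contMDiff : ContMDiff 𝓘(ℝ, E) (𝓘(ℝ, E).prod 𝓘(ℝ, E →L[ℝ] E →L[ℝ] ℝ)) ∞
    (fun x ↦ TotalSpace.mk' (E →L[ℝ] E →L[ℝ] ℝ) x (val x))

/-- `nabla` is the Levi-Civita connection of `g`: it is metric and torsion free.
Here and below `nabla Y x (X x)` stands for `(∇_X Y)(x)`. -/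
structure IsLeviCivita (g : PseudoRiemannianMetric E M)
    (nabla : CovariantDerivative 𝓘(ℝ, E) E (TangentSpace 𝓘(ℝ, E) : M → Type _)) : Prop where
  torsion_eq_zero : nabla.torsion = 0
  metric : ∀ (x : M) (Y Z : Π x : M, TangentSpace 𝓘(ℝ, E) x),
    SectionDiffAt E E Y x → SectionDiffAt E E Z x → ∀ v : TangentSpace 𝓘(ℝ, E) x,
      mvfderiv 𝓘(ℝ, E) (fun p ↦ g.val p (Y p) (Z p)) x v
        = g.val x (nabla Y x v) (Z x) + g.val x (Y x) (nabla Z x v)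

/-- A pseudo-orthonormal basis of `T_xM`. -/
def IsOrthonormalBasis (g : PseudoRiemannianMetric E M) {x : M} {d : ℕ}
    (e : Module.Basis (Fin d) ℝ (TangentSpace 𝓘(ℝ, E) x)) : Prop :=
  (∀ i j, i ≠ j → g.val x (e i) (e j) = 0) ∧
    ∀ i, g.val x (e i) (e i) = 1 ∨ g.val x (e i) (e i) = -1

/-! ### The spinor bundle -/

variable {F : Type*} [NormedAddCommGroup F] [NormedSpace ℂ F] [FiniteDimensional ℂ F]
  {S : M → Type*} [TopologicalSpace (TotalSpace F S)]
  [∀ x, AddCommGroup (S x)] [∀ x, Module ℂ (S x)] [∀ x, TopologicalSpace (S x)]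
  [∀ x, IsTopologicalAddGroup (S x)] [∀ x, ContinuousSMul ℝ (S x)]
  [FiberBundle F S] [VectorBundle ℝ F S] [ContMDiffVectorBundle ∞ F S 𝓘(ℝ, E)]

variable (F S) in
/-- A Clifford multiplication on the complex vector bundle `S` over a manifold of dimension `2n`,
with the convention `XY + YX = -2 g(X, Y)`. The rank condition says that the Clifford modules
`S_x` are irreducible, so that `S` is a bundle of spinors. -/
structure CliffordMultiplication (n : ℕ) (g : PseudoRiemannianMetric E M) where
  val (x : M) : TangentSpace 𝓘(ℝ, E) x →L[ℝ] S x →L[ℝ] S x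
  map_complex_smul (x : M) (v : TangentSpace 𝓘(ℝ, E) x) (c : ℂ) (ψ : S x) :
    val x v (c • ψ) = c • val x v ψ
  clifford (x : M) (v w : TangentSpace 𝓘(ℝ, E) x) (ψ : S x) :
    val x v (val x w ψ) + val x w (val x v ψ) = (-2 * g.val x v w) • ψ
  finrank_eq : Module.finrank ℂ F = 2 ^ n
  contMDiff : ContMDiff 𝓘(ℝ, E) (𝓘(ℝ, E).prod 𝓘(ℝ, E →L[ℝ] F →L[ℝ] F)) ∞
    (fun x ↦ TotalSpace.mk' (E →L[ℝ] F →L[ℝ] F) x (val x))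

/-- `γ(v)` as a complex linear endomorphism of `S_x`. -/
def CliffordMultiplication.toEnd {n : ℕ} {g : PseudoRiemannianMetric E M}
    (γ : CliffordMultiplication F S n g) (x : M) (v : TangentSpace 𝓘(ℝ, E) x) :
    Module.End ℂ (S x) where
  toFun ψ := γ.val x v ψ
  map_add' ψ φ := map_add _ ψ φ
  map_smul' c ψ := γ.map_complex_smul x v c ψ

/-- The value at `x` of `γ* = γ¹ ⋯ γ²ⁿ` or `i γ¹ ⋯ γ²ⁿ` computed in the pseudo-orthonormal basis
`e`, where `γ^μ = g(e_μ, e_μ) γ(e_μ)`; the factor `i` is absent if and only if the signature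
`2n - 2t` is divisible by `4`, where `t` is the number of time-like vectors of `e`. -/
def chiralityOfBasis {n : ℕ} {g : PseudoRiemannianMetric E M}
    (γ : CliffordMultiplication F S n g) {x : M}
    (e : Module.Basis (Fin (2 * n)) ℝ (TangentSpace 𝓘(ℝ, E) x)) : Module.End ℂ (S x) :=
  (if (4 : ℤ) ∣ 2 * (n : ℤ) - 2 * (Nat.card {i // g.val x (e i) (e i) = -1} : ℤ)
    then (1 : ℂ) else Complex.I) •
  (List.ofFn fun i ↦ ((g.val x (e i) (e i) : ℝ) : ℂ) • γ.toEnd x (e i)).prod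

/-- `γs` is the chirality operator `γ*`. In a point, the values in any two pseudo-orthonormal bases
differ by the sign of the determinant of the change of basis; a choice of sign for which
`γs` is smooth is the same thing as an orientation of `M`. -/
structure IsChiralityOperator {n : ℕ} {g : PseudoRiemannianMetric E M}
    (γ : CliffordMultiplication F S n g) (γs : Π x : M, Module.End ℂ (S x)) : Prop where
  eq_chiralityOfBasis : ∀ x : M, ∃ e : Module.Basis (Fin (2 * n)) ℝ (TangentSpace 𝓘(ℝ, E) x),
    IsOrthonormalBasis g e ∧ γs x = chiralityOfBasis γ e
  contMDiffAt : ∀ (x : M) (ψ : Π x : M, S x),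
    ContMDiffAt 𝓘(ℝ, E) (𝓘(ℝ, E).prod 𝓘(ℝ, F)) ∞ (T% ψ) x →
    ContMDiffAt 𝓘(ℝ, E) (𝓘(ℝ, E).prod 𝓘(ℝ, F)) ∞
      (fun p ↦ TotalSpace.mk' F p (γs p (ψ p))) x

/-- A charge conjugation: a nondegenerate complex bilinear form `C` on `S` such that
`C_0(φ, ψ) = C(φ, ψ)` has the symmetry `Δ₀` and `C_1(φ, ψ)(v) = C(φ, γ(v) ψ)` the
symmetry `Δ₁`. (This implies that it is spin-invariant.) -/
structure ChargeConjugation {n : ℕ} {g : PseudoRiemannianMetric E M}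
    (γ : CliffordMultiplication F S n g) where
  val (x : M) : S x →L[ℝ] S x →L[ℝ] ℂ
  smul_left (x : M) (c : ℂ) (φ ψ : S x) : val x (c • φ) ψ = c * val x φ ψ
  smul_right (x : M) (c : ℂ) (φ ψ : S x) : val x φ (c • ψ) = c * val x φ ψ
  nondegenerate (x : M) (φ : S x) (hφ : ∀ ψ, val x φ ψ = 0) : φ = 0
  Δ₀ : ℤˣ
  Δ₁ : ℤˣ
  symm_zero (x : M) (φ ψ : S x) : val x φ ψ = ((Δ₀ : ℤ) : ℂ) * val x ψ φ
  symm_one (x : M) (v : TangentSpace 𝓘(ℝ, E) x) (φ ψ : S x) :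
    val x φ (γ.val x v ψ) = ((Δ₁ : ℤ) : ℂ) * val x ψ (γ.val x v φ)
  contMDiff : ContMDiff 𝓘(ℝ, E) (𝓘(ℝ, E).prod 𝓘(ℝ, F →L[ℝ] F →L[ℝ] ℂ)) ∞
    (fun x ↦ TotalSpace.mk' (F →L[ℝ] F →L[ℝ] ℂ) x (val x))

/-- `nablaS` is the connection on the spinor bundle induced by the Levi-Civita connection `nabla`:
the unique complex linear connection for which Clifford multiplication and charge conjugation
are parallel. -/
structure IsSpinLeviCivita {n : ℕ} {g : PseudoRiemannianMetric E M}
    {γ : CliffordMultiplication F S n g} (C : ChargeConjugation γ)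
    (nabla : CovariantDerivative 𝓘(ℝ, E) E (TangentSpace 𝓘(ℝ, E) : M → Type _))
    (nablaS : CovariantDerivative 𝓘(ℝ, E) F S) : Prop where
  complex_linear : ∀ (x : M) (ψ : Π x : M, S x), SectionDiffAt E F ψ x →
    ∀ (c : ℂ) (v : TangentSpace 𝓘(ℝ, E) x), nablaS (c • ψ) x v = c • nablaS ψ x v
  clifford_parallel : ∀ (x : M) (Y : Π x : M, TangentSpace 𝓘(ℝ, E) x) (ψ : Π x : M, S x),
    SectionDiffAt E E Y x → SectionDiffAt E F ψ x → ∀ v : TangentSpace 𝓘(ℝ, E) x,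
      nablaS (fun p ↦ γ.val p (Y p) (ψ p)) x v
        = γ.val x (nabla Y x v) (ψ x) + γ.val x (Y x) (nablaS ψ x v)
  charge_parallel : ∀ (x : M) (φ ψ : Π x : M, S x),
    SectionDiffAt E F φ x → SectionDiffAt E F ψ x → ∀ v : TangentSpace 𝓘(ℝ, E) x,
      mvfderiv 𝓘(ℝ, E) (fun p ↦ C.val p (φ p) (ψ p)) x v
        = C.val x (nablaS φ x v) (ψ x) + C.val x (φ x) (nablaS ψ x v)

/-! ### The twisted spinor bundle `S ⊕ S` -/

/-- A section of the direct sum is differentiable in a point iff both components are. -/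
theorem sectionDiffAt_pair_iff {E : Type*} [NormedAddCommGroup E] [NormedSpace ℝ E]
    {M : Type*} [TopologicalSpace M] [ChartedSpace E M]
    {G : Type*} [NormedAddCommGroup G] [NormedSpace ℝ G]
    {V : M → Type*} [TopologicalSpace (TotalSpace G V)] [∀ x, Zero (V x)] [∀ x, TopologicalSpace (V x)]
    [FiberBundle G V] (σ : Π x : M, (V ×ᵇ V) x) (x : M) :
    SectionDiffAt E (G × G) (V := V ×ᵇ V) σ x ↔
      SectionDiffAt E G (V := V) (fun p ↦ (σ p).1) x ∧
      SectionDiffAt E G (V := V) (fun p ↦ (σ p).2) x := by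
  unfold SectionDiffAt
  rw [mdifferentiableAt_section, mdifferentiableAt_section, mdifferentiableAt_section]
  exact mdifferentiableAt_prod_module_iff _

/-- The connection `∇ ⊕ ∇` on `S ⊕ S`. -/
def sumConnection (nablaS : CovariantDerivative 𝓘(ℝ, E) F S) :
    CovariantDerivative 𝓘(ℝ, E) (F × F) (S ×ᵇ S) where
  toFun σ x := (nablaS (fun p ↦ (σ p).1) x).prod (nablaS (fun p ↦ (σ p).2) x)
  isCovariantDerivativeOnUniv := by
    constructor
    · intro σ σ' x hσ hσ' _
      have h := (sectionDiffAt_pair_iff σ x).1 hσ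
      have h' := (sectionDiffAt_pair_iff σ' x).1 hσ'
      ext v
      · exact congrArg (fun L ↦ L v) (nablaS.isCovariantDerivativeOnUniv.add h.1 h'.1)
      · exact congrArg (fun L ↦ L v) (nablaS.isCovariantDerivativeOnUniv.add h.2 h'.2)
    · intro σ f x hσ hf _
      have h := (sectionDiffAt_pair_iff σ x).1 hσ
      ext v
      · exact congrArg (fun L ↦ L v) (nablaS.isCovariantDerivativeOnUniv.leibniz h.1 hf)
      · exact congrArg (fun L ↦ L v) (nablaS.isCovariantDerivativeOnUniv.leibniz h.2 hf)

/-- Clifford multiplication `γ(v) ⊗ 1` on `S ⊕ S`. -/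
def cliffordSum {n : ℕ} {g : PseudoRiemannianMetric E M} (γ : CliffordMultiplication F S n g)
    (x : M) (v : TangentSpace 𝓘(ℝ, E) x) : Module.End ℂ (S x × S x) :=
  twist (γ.toEnd x v) 1

/-- The charge conjugation `C ⊗ τ_k` on `S ⊕ S`, that is
`(C ⊗ τ_k)(φ, ψ) = (C ⊕ C)(φ, (1 ⊗ τ_k) ψ)`. For `k = 0` it is `C ⊕ C`. -/
def chargeSum {n : ℕ} {g : PseudoRiemannianMetric E M} {γ : CliffordMultiplication F S n g}
    (C : ChargeConjugation γ) (k : Fin 4) (x : M) (φ ψ : S x × S x) : ℂ :=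
  C.val x φ.1 (twist 1 (tau k) ψ).1 + C.val x φ.2 (twist 1 (tau k) ψ).2

/-- The operator `1 ⊗ τ_i + w γ* ⊗ τ_j`, for a sign `w`. -/
def chiralProjection (γs : Π x : M, Module.End ℂ (S x)) (i j : Fin 4) (w : ℤˣ) (x : M) :
    Module.End ℂ (S x × S x) :=
  twist 1 (tau i) + ((w : ℤ) : ℂ) • twist (γs x) (tau j)

/-- Connections on the real vector bundle underlying `S ⊕ S`. -/
abbrev SumConnection (E F : Type*) [NormedAddCommGroup E] [NormedSpace ℝ E]
    [NormedAddCommGroup F] [NormedSpace ℂ F]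
    {M : Type*} [TopologicalSpace M] [ChartedSpace E M]
    (S : M → Type*) [TopologicalSpace (TotalSpace F S)]
    [∀ x, AddCommGroup (S x)] [∀ x, Module ℂ (S x)] [∀ x, TopologicalSpace (S x)]
    [∀ x, IsTopologicalAddGroup (S x)] [∀ x, ContinuousSMul ℝ (S x)] [FiberBundle F S] :=
  CovariantDerivative 𝓘(ℝ, E) (F × F) (S ×ᵇ S)

/-- `D` is a connection on the complex vector bundle `S ⊕ S`. -/
def IsComplexLinear (D : SumConnection E F S) : Prop :=
  ∀ (x : M) (ψ : Π x : M, (S ×ᵇ S) x), SectionDiffAt E (F × F) (V := S ×ᵇ S) ψ x →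
    ∀ (c : ℂ) (v : TangentSpace 𝓘(ℝ, E) x), D (fun p ↦ c • ψ p) x v = c • D ψ x v

/-- `DC` is the connection `D^C` associated with `D` and the charge conjugation `C ⊗ τ_k`, which
is characterized by `(D ⊗ 1 + 1 ⊗ D^C) (C ⊗ τ_k) = 0`. -/
def IsConjugateConnection {n : ℕ} {g : PseudoRiemannianMetric E M}
    {γ : CliffordMultiplication F S n g} (C : ChargeConjugation γ) (k : Fin 4)
    (D DC : SumConnection E F S) : Prop :=
  ∀ (x : M) (φ ψ : Π x : M, (S ×ᵇ S) x), SectionDiffAt E (F × F) (V := S ×ᵇ S) φ x →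
    SectionDiffAt E (F × F) (V := S ×ᵇ S) ψ x → ∀ v : TangentSpace 𝓘(ℝ, E) x,
      mvfderiv 𝓘(ℝ, E) (fun p ↦ chargeSum C k p (φ p) (ψ p)) x v
        = chargeSum C k x (D φ x v) (ψ x) + chargeSum C k x (φ x) (DC ψ x v)

/-- `(D̂_Z γ)(X) ξ = D_Z (γ(X) ξ) - γ(∇_Z X) ξ - γ(X) D^C_Z ξ`. -/
def hatD {n : ℕ} {g : PseudoRiemannianMetric E M} (γ : CliffordMultiplication F S n g)
    (nabla : CovariantDerivative 𝓘(ℝ, E) E (TangentSpace 𝓘(ℝ, E) : M → Type _))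
    (D DC : SumConnection E F S) (Z X : Π x : M, TangentSpace 𝓘(ℝ, E) x)
    (ξ : Π x : M, (S ×ᵇ S) x) (x : M) : S x × S x :=
  D (fun p ↦ cliffordSum γ p (X p) (ξ p)) x (Z x)
    - cliffordSum γ x (nabla X x (Z x)) (ξ x)
    - cliffordSum γ x (X x) (DC ξ x (Z x))

/-- The torsion `T(X, Y) ξ` of `D`: two times the skew symmetrization of `D̂γ`. -/
def spinTorsion {n : ℕ} {g : PseudoRiemannianMetric E M} (γ : CliffordMultiplication F S n g)
    (nabla : CovariantDerivative 𝓘(ℝ, E) E (TangentSpace 𝓘(ℝ, E) : M → Type _))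
    (D DC : SumConnection E F S) (X Y : Π x : M, TangentSpace 𝓘(ℝ, E) x)
    (ξ : Π x : M, (S ×ᵇ S) x) (x : M) : S x × S x :=
  hatD γ nabla D DC X Y ξ x - hatD γ nabla D DC Y X ξ x

/-- `D` is admissible: `D̂γ` is skew symmetric. -/
def IsAdmissible {n : ℕ} {g : PseudoRiemannianMetric E M} {γ : CliffordMultiplication F S n g}
    (C : ChargeConjugation γ) (k : Fin 4)
    (nabla : CovariantDerivative 𝓘(ℝ, E) E (TangentSpace 𝓘(ℝ, E) : M → Type _))
    (D : SumConnection E F S) : Prop :=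
  ∃ DC : SumConnection E F S, IsConjugateConnection C k D DC ∧
    ∀ (x : M) (X Y : Π x : M, TangentSpace 𝓘(ℝ, E) x) (ξ : Π x : M, (S ×ᵇ S) x),
      SectionDiffAt E E X x → SectionDiffAt E E Y x →
      SectionDiffAt E (F × F) (V := S ×ᵇ S) ξ x →
      hatD γ nabla D DC X Y ξ x = - hatD γ nabla D DC Y X ξ x

/-- The `End(S ⊕ S)`-valued one-form `A` is proportional to `P`: it is `A_v = (B_v ⊗ 1) P` for a
one-form `B` with values in `End(S)`. -/
def IsProportionalOneForm
    (A : Π x : M, (S ×ᵇ S) x →L[ℝ] TangentSpace 𝓘(ℝ, E) x →L[ℝ] (S ×ᵇ S) x)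
    (P : Π x : M, Module.End ℂ (S x × S x)) : Prop :=
  ∃ B : Π x : M, TangentSpace 𝓘(ℝ, E) x →ₗ[ℝ] Module.End ℂ (S x),
    ∀ (x : M) (v : TangentSpace 𝓘(ℝ, E) x) (ψ : S x × S x), A x ψ v = twist (B x v) 1 (P x ψ)

/-- The tensor `T`, given by its values `T(X, Y) ξ` on vector fields and sections, is proportional
to `P`: it is `T(X, Y) = (B(X, Y) ⊗ 1) P` for a two-form `B` with values in `End(S)`. -/
def IsProportionalTwoForm
    (T : (Π x : M, TangentSpace 𝓘(ℝ, E) x) → (Π x : M, TangentSpace 𝓘(ℝ, E) x) →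
      (Π x : M, (S ×ᵇ S) x) → Π x : M, S x × S x)
    (P : Π x : M, Module.End ℂ (S x × S x)) : Prop :=
  ∃ B : Π x : M, TangentSpace 𝓘(ℝ, E) x →ₗ[ℝ] TangentSpace 𝓘(ℝ, E) x →ₗ[ℝ] Module.End ℂ (S x),
    (∀ (x : M) (v : TangentSpace 𝓘(ℝ, E) x), B x v v = 0) ∧
    ∀ (x : M) (X Y : Π x : M, TangentSpace 𝓘(ℝ, E) x) (ξ : Π x : M, (S ×ᵇ S) x),
      SectionDiffAt E E X x → SectionDiffAt E E Y x →
      SectionDiffAt E (F × F) (V := S ×ᵇ S) ξ x →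
      T X Y ξ x = twist (B x (X x) (Y x)) 1 (P x (ξ x))

end Geometry

end SpinTorsion

end

set_option linter.unusedSectionVars false

/-! Write A_v = (B_v ⊗ 1) P_w and let A^C_v be the negative adjoint of A_v for C ⊗ τ_k. Subtracting
the defining equations of two conjugate connections gives D^C - (D - A)^C = A^C, whatever D is
(`exists_conjugate_sub`). So A^C may be studied over the Levi-Civita connection ∇. There ∇^C = ∇ and
∇̂γ = 0, and admissibility of ∇ + A says that A_X γ(Y) - γ(Y) A^C_X is skew in X and Y.

The chirality operator anticommutes with every γ(u), because the dimension is even; hence P_w γ(u) =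
γ(u) P_{-w}. On the diagonal X = Y = e_l of an orthonormal basis, skewness becomes γ(e_l) A^C_{e_l}
= (B_{e_l} γ(e_l) ⊗ 1) P_{-w}. Since e_l is not null, γ(e_l) is invertible, and A^C_{e_l} is a left
multiple of P_{-w}; linearity extends this to all vectors. `exists_opposite_proportional` carries
this out, with the new coefficient expressed through adjoints.

In the torsion, A_X γ(Y) = (B_X γ(Y) ⊗ 1) P_{-w} and γ(Y) A^C_X are both left multiples of P_{-w},
and so is their skew symmetrization. -/

namespace SpinTorsion

/-! ### Products of pairwise anticommuting ring elements -/

section Anticommuting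

variable {R : Type*} [Ring R]

theorem mul_list_prod_of_anticommute (x : R) (l : List R) (h : ∀ y ∈ l, x * y = -(y * x)) :
    x * l.prod = (-1) ^ l.length * (l.prod * x) := by
  induction l with
  | nil => simp
  | cons a t ih =>
    have ha := h a (by simp)
    have ht := ih fun y hy ↦ h y (by simp [hy])
    rw [List.prod_cons, List.length_cons, ← mul_assoc, ha, neg_mul, mul_assoc, ht, pow_succ,
      ← mul_assoc a, ((Commute.neg_one_left a).pow_left _).eq.symm]
    noncomm_ring

theorem list_prod_mul_of_anticommute (x : R) (l : List R) (h : ∀ y ∈ l, x * y = -(y * x)) :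
    l.prod * x = (-1) ^ l.length * (x * l.prod) := by
  rw [mul_list_prod_of_anticommute x l h, ← mul_assoc, ← pow_add, ← two_mul, pow_mul]
  simp

/-- The factor anticommutes with the m - 1 others and commutes with itself; the exponent m + 1 has
the parity of m - 1 and avoids natural subtraction. -/
theorem mul_prod_ofFn_of_anticommute (m : ℕ) (f : Fin m → R)
    (h : ∀ i j, i ≠ j → f i * f j = -(f j * f i)) (i : Fin m) :
    f i * (List.ofFn f).prod = (-1) ^ (m + 1) * ((List.ofFn f).prod * f i) := by
  induction m with
  | zero => exact i.elim0
  | succ m ih =>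
    rw [List.ofFn_succ, List.prod_cons]
    refine Fin.cases ?_ (fun k ↦ ?_) i
    · have := list_prod_mul_of_anticommute (f 0) (List.ofFn fun i : Fin m ↦ f i.succ) (by
        intro y hy
        obtain ⟨j, rfl⟩ := (List.mem_ofFn' _ _).1 hy
        exact h _ _ (Fin.succ_ne_zero j).symm)
      rw [List.length_ofFn] at this
      rw [mul_assoc, this, ← mul_assoc (f 0) ((-1) ^ m), ((Commute.neg_one_left (f 0)).pow_left _).eq.symm,
        mul_assoc, ← mul_assoc ((-1) ^ (m + 1 + 1)), ← pow_add,
        show m + 1 + 1 + m = 2 * (m + 1) by ring, pow_mul]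
      simp
    · have := ih (fun i ↦ f i.succ) (fun i j hij ↦ h _ _ (by simpa using hij)) k
      rw [← mul_assoc, h _ _ (Fin.succ_ne_zero k), neg_mul, mul_assoc, this, ← mul_assoc (f 0),
        ((Commute.neg_one_left (f 0)).pow_left _).eq.symm, pow_succ _ (m + 1)]
      noncomm_ring

/-- Bringing equal factors together costs one sign for each pair of indices. In the induction the
first factor crosses m others, matching the Pascal rule for `choose 2`. -/
theorem prod_ofFn_mul_self_of_anticommute {R : Type*} [Ring R] [Algebra ℂ R] (m : ℕ)
    (f : Fin m → R) (c : Fin m → ℂ) (h : ∀ i j, i ≠ j → f i * f j = -(f j * f i))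
    (hc : ∀ i, f i * f i = c i • 1) :
    (List.ofFn f).prod * (List.ofFn f).prod = ((-1) ^ (m.choose 2) * ∏ i, c i) • (1 : R) := by
  induction m with
  | zero => simp
  | succ m ih =>
    have h1 := ih (fun i ↦ f i.succ) (fun i ↦ c i.succ)
      (fun i j hij ↦ h _ _ (by simpa using hij)) (fun i ↦ hc _)
    have := list_prod_mul_of_anticommute (f 0) (List.ofFn fun i : Fin m ↦ f i.succ) (by
        intro y hy
        obtain ⟨j, rfl⟩ := (List.mem_ofFn' _ _).1 hy
        exact h _ _ (Fin.succ_ne_zero j).symm)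
    rw [List.length_ofFn] at this
    rw [List.ofFn_succ, List.prod_cons, Fin.prod_univ_succ, Nat.choose_succ_succ' m 1]
    set P := (List.ofFn fun i : Fin m ↦ f i.succ).prod
    have hs : (-1 : R) ^ m = ((-1 : ℂ) ^ m) • 1 := by
      rw [← Algebra.algebraMap_eq_smul_one]; simp
    calc f 0 * P * (f 0 * P) = f 0 * (P * f 0) * P := by noncomm_ring
      _ = (-1 : ℂ) ^ m • ((f 0 * f 0) * (P * P)) := by
        rw [this, hs]; simp [mul_assoc]
      _ = _ := by
        rw [hc, h1, smul_mul_smul_comm, one_mul, smul_smul, Nat.choose_one_right, pow_add]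
        congr 1
        ring

end Anticommuting

/-! ### Adjoints on V ⊗ ℂ² and the fibrewise argument -/

section Adjoint

variable {V : Type*} [AddCommGroup V] [Module ℂ V]

@[simp]
theorem twist_apply (f : Module.End ℂ V) (m : Matrix (Fin 2) (Fin 2) ℂ) (ψ : V × V) :
    twist f m ψ = (m 0 0 • f ψ.1 + m 0 1 • f ψ.2, m 1 0 • f ψ.1 + m 1 1 • f ψ.2) := rfl

/-- In finite dimension, separation on the right makes ψ ↦ b(·, ψ) an isomorphism onto the dual; the
adjoint is the dual map conjugated by it. -/
theorem exists_adjoint [FiniteDimensional ℂ V] (b : V →ₗ[ℂ] V →ₗ[ℂ] ℂ)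
    (hr : ∀ ψ, (∀ φ, b φ ψ = 0) → ψ = 0) :
    ∃ adj : Module.End ℂ V →ₗ[ℂ] Module.End ℂ V, ∀ f φ ψ, b (f φ) ψ = b φ (adj f ψ) := by
  have hinj : Function.Injective b.flip := by
    refine (injective_iff_map_eq_zero b.flip).2 fun ψ hψ ↦ hr ψ fun φ ↦ ?_
    exact LinearMap.congr_fun hψ φ
  let e : V ≃ₗ[ℂ] Module.Dual ℂ V :=
    LinearEquiv.ofInjectiveOfFinrankEq b.flip hinj Subspace.dual_finrank_eq.symm
  have he : ∀ φ ψ, e ψ φ = b φ ψ := fun φ ψ ↦ rfl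
  refine ⟨{ toFun f := e.symm.toLinearMap ∘ₗ f.dualMap ∘ₗ e.toLinearMap
            map_add' f g := ?_
            map_smul' c f := ?_ }, fun f φ ψ ↦ ?_⟩
  · ext ψ
    simp only [LinearMap.comp_apply, LinearMap.add_apply, LinearEquiv.coe_coe, ← map_add]
    congr 1
    ext φ
    simp
  · ext ψ
    simp only [LinearMap.comp_apply, LinearMap.smul_apply, LinearEquiv.coe_coe, ← map_smul,
      RingHom.id_apply]
    congr 1
    ext φ
    simp
  · rw [← he φ]
    simp [he]

/-- The bilinear form `b ⊗ m` on `V ⊕ V`. -/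
noncomputable def twistForm (b : V →ₗ[ℂ] V →ₗ[ℂ] ℂ) (m : Matrix (Fin 2) (Fin 2) ℂ) (φ ψ : V × V) : ℂ :=
  b φ.1 (twist 1 m ψ).1 + b φ.2 (twist 1 m ψ).2

/-- Each τ_i is symmetric or skew, and any two of the τ commute or anticommute. Consequently the
adjoint of f ⊗ τ_i for b ⊗ τ_k is again of the form ± f' ⊗ τ_i, with the same τ_i. -/
theorem exists_tau_sign (k i : Fin 4) :
    ∃ ε : ℂ, ε * ε = 1 ∧ (tau i).transpose * tau k = ε • (tau k * tau i) := by
  fin_cases k <;> fin_cases i <;>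
  first
  | (refine ⟨1, by norm_num, ?_⟩
     ext a b
     fin_cases a <;> fin_cases b <;> simp [tau, Matrix.mul_apply]
     done)
  | (refine ⟨-1, by norm_num, ?_⟩
     ext a b
     fin_cases a <;> fin_cases b <;> simp [tau, Matrix.mul_apply])

theorem twistForm_twist_left (b : V →ₗ[ℂ] V →ₗ[ℂ] ℂ)
    (adj : Module.End ℂ V →ₗ[ℂ] Module.End ℂ V) (hadj : ∀ f φ ψ, b (f φ) ψ = b φ (adj f ψ))
    (m m' : Matrix (Fin 2) (Fin 2) ℂ) (ε : ℂ) (h : m'.transpose * m = ε • (m * m'))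
    (f : Module.End ℂ V) (φ ψ : V × V) :
    twistForm b m (twist f m' φ) ψ = twistForm b m φ (ε • twist (adj f) m' ψ) := by
  have h00 := congrFun (congrFun h 0) 0
  have h01 := congrFun (congrFun h 0) 1
  have h10 := congrFun (congrFun h 1) 0
  have h11 := congrFun (congrFun h 1) 1
  simp only [Matrix.mul_apply, Matrix.transpose_apply, Fin.sum_univ_two, Matrix.smul_apply,
    smul_eq_mul] at h00 h01 h10 h11
  simp only [twistForm, twist_apply, map_add, map_smul, LinearMap.add_apply, LinearMap.smul_apply,
    smul_eq_mul, Prod.smul_fst, Prod.smul_snd, Module.End.one_apply, hadj]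
  linear_combination (b φ.1 (adj f ψ.1)) * h00 + (b φ.1 (adj f ψ.2)) * h01
    + (b φ.2 (adj f ψ.1)) * h10 + (b φ.2 (adj f ψ.2)) * h11

theorem twist_tau_injective (k : Fin 4) (ψ : V × V) (h : twist (1 : Module.End ℂ V) (tau k) ψ = 0) :
    ψ = 0 := by
  obtain ⟨a, c⟩ := ψ
  fin_cases k <;> simp_all [tau]

theorem twistForm_separatingRight (b : V →ₗ[ℂ] V →ₗ[ℂ] ℂ)
    (hr : ∀ ψ, (∀ φ, b φ ψ = 0) → ψ = 0) (k : Fin 4) (ψ : V × V)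
    (h : ∀ φ, twistForm b (tau k) φ ψ = 0) : ψ = 0 := by
  refine twist_tau_injective k ψ (Prod.ext (hr _ fun φ ↦ ?_) (hr _ fun φ ↦ ?_))
  · simpa [twistForm] using h (φ, 0)
  · simpa [twistForm] using h (0, φ)

theorem twist_tau_independent {i j : Fin 4} (hij : i ≠ j) (f h : Module.End ℂ V)
    (hfh : ∀ ψ, twist f (tau i) ψ + twist h (tau j) ψ = 0) : f = 0 ∧ h = 0 := by
  have key (ψ : V) : f ψ = 0 ∧ h ψ = 0 := by
    have h1 := hfh (ψ, 0)
    have h2 := hfh (0, ψ)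
    have half (a : V) (e : a + a = 0) : a = 0 := by simpa [← two_smul ℂ] using e
    fin_cases i <;> fin_cases j <;>
    first
    | exact absurd rfl hij
    | skip
    all_goals
      simp [tau] at h1 h2
      first
      | exact h1
      | exact h1.symm
      | (have e1 : f ψ = 0 := half _ (by linear_combination (norm := module) h1 + h2)
         exact ⟨e1, by simpa [e1] using h1⟩)
      | (have e1 : f ψ = 0 := half _ (by linear_combination (norm := module) h1 - h2)
         exact ⟨e1, by simpa [e1] using h1⟩)
      | (have e1 : f ψ = 0 := half _ (by linear_combination (norm := module) h2 - h1)
         exact ⟨e1, by simpa [e1] using h1⟩)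
  exact ⟨LinearMap.ext fun ψ ↦ (key ψ).1, LinearMap.ext fun ψ ↦ (key ψ).2⟩

theorem twist_tau_eq_zero (i : Fin 4) (f : Module.End ℂ V) (hf : ∀ ψ, twist f (tau i) ψ = 0) :
    f = 0 := by
  ext ψ
  have := hf (ψ, 0)
  fin_cases i <;> simpa [tau] using this

/-- The fibrewise core: the negative adjoint of `(B_v ⊗ 1) (1 ⊗ τ_i + w γ* ⊗ τ_j)` is
proportional to the opposite operator, provided that admissibility holds on a basis of
vectors with invertible Clifford action. -/
theorem exists_opposite_proportional {T ι : Type*} [AddCommGroup T] [Module ℝ T]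
    (e : Module.Basis ι ℝ T) (adj : Module.End ℂ V →ₗ[ℂ] Module.End ℂ V)
    (cl : T → Module.End ℂ V) (G : Module.End ℂ V) (hG : G * G = 1)
    (hcl : ∀ l, ∀ f : Module.End ℂ V, cl (e l) * f = 0 → f = 0)
    (hGcl : ∀ l, G * cl (e l) = -(cl (e l) * G))
    (B : T →ₗ[ℝ] Module.End ℂ V) (i j : Fin 4) (w : ℂ) (hw : w * w = 1) (εi εj : ℂ)
    (hεi : εi * εi = 1) (hij : i = j → εi = εj)
    (hadm : ∀ l ψ, twist (B (e l)) 1 (twist 1 (tau i) (twist (cl (e l)) 1 ψ)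
        + w • twist G (tau j) (twist (cl (e l)) 1 ψ))
      = twist (cl (e l)) 1 (-(εi • twist (adj (B (e l))) (tau i) ψ
        + (w * εj) • twist (adj (B (e l) * G)) (tau j) ψ))) :
    ∃ B' : T →ₗ[ℝ] Module.End ℂ V, ∀ v ψ,
      -(εi • twist (adj (B v)) (tau i) ψ + (w * εj) • twist (adj (B v * G)) (tau j) ψ)
        = twist (B' v) 1 (twist 1 (tau i) ψ - w • twist G (tau j) ψ) := by
  -- With b the adjoint of B and d that of B G, the negative adjoint is -(εi b ⊗ τ_i + w εj d ⊗
  -- τ_j).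
  let b : T →ₗ[ℝ] Module.End ℂ V := adj.restrictScalars ℝ ∘ₗ B
  let d : T →ₗ[ℝ] Module.End ℂ V :=
    adj.restrictScalars ℝ ∘ₗ (LinearMap.mulRight ℂ G).restrictScalars ℝ ∘ₗ B
  have hb (v) : adj (B v) = b v := rfl
  have hd (v) : adj (B v * G) = d v := rfl
  simp only [hb, hd] at hadm ⊢
  by_cases h : i = j
  · subst h
    obtain rfl := hij rfl
    -- For i = j the two terms merge into -εi K ⊗ τ_i, and the opposite operator is (1 - w G) ⊗ τ_i.
    -- The point is to show that w K G = -K.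
    let K : T →ₗ[ℝ] Module.End ℂ V := b + (w • (LinearMap.id : Module.End ℂ V →ₗ[ℂ] _)).restrictScalars ℝ ∘ₗ d
    have hK (v) : K v = b v + w • d v := rfl
    have hKe (l) : K (e l) + w • (K (e l) * G) = 0 := by
      have h1 : B (e l) * cl (e l) + w • (B (e l) * G * cl (e l)) + εi • (cl (e l) * K (e l)) = 0 := by
        refine twist_tau_eq_zero i _ fun ψ ↦ ?_
        have := hadm l ψ
        rw [← sub_eq_zero] at this
        rw [← this]
        ext <;> simp [hK] <;> module
      have h2 : B (e l) * cl (e l) * G + w • (B (e l) * G * cl (e l) * G)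
          + εi • (cl (e l) * K (e l) * G) = 0 := by
        have := congrArg (· * G) h1
        simpa [add_mul] using this
      have h3 : B (e l) * G * cl (e l) * G = -(B (e l) * cl (e l)) := by
        rw [mul_assoc (B (e l)), hGcl, mul_assoc (B (e l)), neg_mul, mul_assoc (cl (e l)), hG]
        simp
      have h4 : B (e l) * cl (e l) * G = -(B (e l) * G * cl (e l)) := by
        rw [mul_assoc (B (e l)) G, hGcl]
        simp [mul_assoc]
      rw [h3, h4] at h2
      refine hcl l _ ?_
      -- This is `h1` plus w times `h1` multiplied by G on the right; the terms with B cancel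
      -- because w² = 1 and G anticommutes with the Clifford action.
      have h5 : εi • (cl (e l) * (K (e l) + w • (K (e l) * G))) = 0 := by
        have : εi • (cl (e l) * (K (e l) + w • (K (e l) * G)))
          = (B (e l) * cl (e l) + w • (B (e l) * G * cl (e l)) + εi • (cl (e l) * K (e l)))
            + w • (-(B (e l) * G * cl (e l)) + w • (-(B (e l) * cl (e l)))
          + εi • (cl (e l) * K (e l) * G)) + (w * w - 1) • (B (e l) * cl (e l)) := by
          rw [mul_add, mul_smul_comm, mul_assoc]
          module
        rw [this, h1, h2, hw]; simp
      have hε : εi ≠ 0 := by rintro rfl; simp at hεi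
      exact (smul_eq_zero.1 h5).resolve_left hε
    have hKG (v) : w • (K v * G) = -K v := by
      have : K + (w • (LinearMap.mulRight ℂ G)).restrictScalars ℝ ∘ₗ K = 0 :=
        e.ext fun l ↦ hKe l
      have := LinearMap.congr_fun this v
      exact eq_neg_of_add_eq_zero_right this
    -- The factor 1/2 compensates K (1 - w G) = 2 K.
    refine ⟨((-(εi / 2)) • (LinearMap.id : Module.End ℂ V →ₗ[ℂ] _)).restrictScalars ℝ ∘ₗ K,
      fun v ψ ↦ ?_⟩
    have hB' : (((-(εi / 2)) • (LinearMap.id : Module.End ℂ V →ₗ[ℂ] _)).restrictScalars ℝ ∘ₗ K) v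
      = (-(εi / 2)) • K v := rfl
    rw [hB']
    have e1 (φ : V) : K v (G φ) = (w * w) • K v (G φ) := by rw [hw, one_smul]
    have e2 (φ : V) : w • K v (G φ) = - K v φ := LinearMap.congr_fun (hKG v) φ
    have e3 (φ : V) : K v (G φ) = - (w • K v φ) := by
      rw [e1, mul_smul, e2, smul_neg]
    have e4 (φ : V) : d v φ = w • K v φ - w • b v φ := by
      rw [hK, LinearMap.add_apply, LinearMap.smul_apply, smul_add, smul_smul, hw]; module
    have e5 (φ : V) : (w * w) • K v φ = K v φ := by rw [hw, one_smul]
    have e6 (φ : V) : (w * w) • b v φ = b v φ := by rw [hw, one_smul]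
    have step (x y : ℂ) (φ χ : V) : -(εi • (x • b v φ + y • b v χ)
        + (w * εi) • (x • d v φ + y • d v χ))
        = (-(εi / 2)) • (x • K v φ + y • K v χ - (w • (x • K v (G φ) + y • K v (G χ)))) := by
      rw [e3, e3, e4, e4]
      linear_combination (norm := module) (εi * x) • e6 φ + (εi * y) • e6 χ - (εi/2 * x) • e5 φ - (εi/2 * y) • e5 χ
    ext
    · have := step (tau i 0 0) (tau i 0 1) ψ.1 ψ.2
      simpa using this
    · have := step (tau i 1 0) (tau i 1 1) ψ.1 ψ.2
      simpa using this
  -- For i ≠ j the coefficients of τ_i and τ_j can be compared separately. Multiplying the first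
  -- relation by G on the right and adding the second eliminates B.
  · have hde (l) : εj • d (e l) = -(εi • (b (e l) * G)) := by
      obtain ⟨h1, h2⟩ := twist_tau_independent h
        (B (e l) * cl (e l) + εi • (cl (e l) * b (e l)))
        (w • (B (e l) * G * cl (e l) + εj • (cl (e l) * d (e l)))) fun ψ ↦ by
          have := hadm l ψ
          rw [← sub_eq_zero] at this
          rw [← this]
          ext <;> simp <;> module
      have hw0 : w ≠ 0 := by rintro rfl; simp at hw
      have h2 := (smul_eq_zero.1 h2).resolve_left hw0
      have h4 : B (e l) * cl (e l) * G = -(B (e l) * G * cl (e l)) := by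
        rw [mul_assoc (B (e l)) G, hGcl]
        simp [mul_assoc]
      have h3 := congrArg (· * G) h1
      simp only [add_mul, h4, zero_mul, smul_mul_assoc] at h3
      rw [eq_neg_iff_add_eq_zero]
      refine hcl l _ ?_
      rw [mul_add, mul_smul_comm, mul_smul_comm, ← mul_assoc]
      linear_combination (norm := module) h2 + h3
    have hd' (v) : εj • d v = -(εi • (b v * G)) := by
      have : (εj • (LinearMap.id : Module.End ℂ V →ₗ[ℂ] _)).restrictScalars ℝ ∘ₗ d
        = -((εi • (LinearMap.mulRight ℂ G)).restrictScalars ℝ ∘ₗ b) := e.ext fun l ↦ hde l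
      exact LinearMap.congr_fun this v
    -- The coefficient of τ_i forces -εi b; `hd'` then gives the coefficient of τ_j.
    refine ⟨((-εi) • (LinearMap.id : Module.End ℂ V →ₗ[ℂ] _)).restrictScalars ℝ ∘ₗ b,
      fun v ψ ↦ ?_⟩
    have hB' : (((-εi) • (LinearMap.id : Module.End ℂ V →ₗ[ℂ] _)).restrictScalars ℝ ∘ₗ b) v
      = (-εi) • b v := rfl
    rw [hB']
    have e2 (φ : V) : εj • d v φ = -(εi • b v (G φ)) := LinearMap.congr_fun (hd' v) φ
    ext
    · simp only [twist_apply, Prod.fst_add, Prod.fst_neg, Prod.smul_fst, Prod.fst_sub,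
        Matrix.one_apply_eq, Matrix.one_apply_ne, ne_eq, zero_ne_one, one_ne_zero,
        not_false_eq_true, zero_smul, one_smul, add_zero, zero_add, LinearMap.smul_apply, map_add,
        map_sub, map_smul, Module.End.one_apply]
      linear_combination (norm := module) (-(w * tau j 0 0)) • e2 ψ.1 - (w * tau j 0 1) • e2 ψ.2
    · simp only [twist_apply, Prod.snd_add, Prod.snd_neg, Prod.smul_snd, Prod.snd_sub,
        Matrix.one_apply_eq, Matrix.one_apply_ne, ne_eq, zero_ne_one, one_ne_zero,
        not_false_eq_true, zero_smul, one_smul, add_zero, zero_add, LinearMap.smul_apply, map_add,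
        map_sub, map_smul, Module.End.one_apply]
      linear_combination (norm := module) (-(w * tau j 1 0)) • e2 ψ.1 - (w * tau j 1 1) • e2 ψ.2

end Adjoint

/-! ### Clifford algebra, chirality and charge conjugation at a point -/

section Fibre

variable {E : Type*} [NormedAddCommGroup E] [NormedSpace ℝ E]
  {M : Type*} [TopologicalSpace M] [ChartedSpace E M] [IsManifold 𝓘(ℝ, E) ∞ M]
  {F : Type*} [NormedAddCommGroup F] [NormedSpace ℂ F]
  {S : M → Type*} [TopologicalSpace (TotalSpace F S)]
  [∀ x, AddCommGroup (S x)] [∀ x, Module ℂ (S x)] [∀ x, TopologicalSpace (S x)]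
  [∀ x, IsTopologicalAddGroup (S x)] [∀ x, ContinuousSMul ℝ (S x)]
  [FiberBundle F S] [VectorBundle ℝ F S]
  {n : ℕ} {g : PseudoRiemannianMetric E M} (γ : CliffordMultiplication F S n g) {x : M}

/-- Clifford multiplication as a real linear map into the complex endomorphisms. -/
noncomputable def CliffordMultiplication.toEndₗ (x : M) :
    TangentSpace 𝓘(ℝ, E) x →ₗ[ℝ] Module.End ℂ (S x) where
  toFun v := γ.toEnd x v
  map_add' v w := by
    ext ψ
    change γ.val x (v + w) ψ = γ.val x v ψ + γ.val x w ψ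
    simp
  map_smul' c v := by
    ext ψ
    change γ.val x (c • v) ψ = c • γ.val x v ψ
    simp

theorem toEnd_mul_add_mul (v w : TangentSpace 𝓘(ℝ, E) x) :
    γ.toEnd x v * γ.toEnd x w + γ.toEnd x w * γ.toEnd x v
      = ((-2 * g.val x v w : ℝ) : ℂ) • 1 := by
  ext ψ
  exact γ.clifford x v w ψ

theorem toEnd_mul_self (v : TangentSpace 𝓘(ℝ, E) x) :
    γ.toEnd x v * γ.toEnd x v = ((-g.val x v v : ℝ) : ℂ) • 1 := by
  have h := toEnd_mul_add_mul γ v v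
  have : (2 : ℂ) • (γ.toEnd x v * γ.toEnd x v) = (2 : ℂ) • (((-g.val x v v : ℝ) : ℂ) • 1) := by
    rw [two_smul, h, smul_smul]; push_cast; congr 1; ring
  exact smul_right_injective _ (two_ne_zero (α := ℂ)) this

section Basis

variable {e : Module.Basis (Fin (2 * n)) ℝ (TangentSpace 𝓘(ℝ, E) x)}

/-- An orthonormal basis vector is not null, so its Clifford action squares to ±1. -/
theorem toEnd_mul_cancel (he : IsOrthonormalBasis g e) (l : Fin (2 * n)) (f : Module.End ℂ (S x))
    (h : γ.toEnd x (e l) * f = 0) : f = 0 := by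
  have h1 : γ.toEnd x (e l) * γ.toEnd x (e l) * f = 0 := by rw [mul_assoc, h, mul_zero]
  rw [toEnd_mul_self, smul_mul_assoc, one_mul] at h1
  refine (smul_eq_zero.1 h1).resolve_left ?_
  rcases he.2 l with h | h <;> simp [h]

theorem gammaUp_anticommute (he : IsOrthonormalBasis g e) (i j : Fin (2 * n)) (hij : i ≠ j) :
    (((g.val x (e i) (e i) : ℝ) : ℂ) • γ.toEnd x (e i))
        * (((g.val x (e j) (e j) : ℝ) : ℂ) • γ.toEnd x (e j))
      = -((((g.val x (e j) (e j) : ℝ) : ℂ) • γ.toEnd x (e j))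
        * (((g.val x (e i) (e i) : ℝ) : ℂ) • γ.toEnd x (e i))) := by
  have h := toEnd_mul_add_mul γ (e i) (e j)
  rw [he.1 i j hij] at h
  have h : γ.toEnd x (e i) * γ.toEnd x (e j) = -(γ.toEnd x (e j) * γ.toEnd x (e i)) := by
    rw [eq_neg_iff_add_eq_zero, h]; simp
  rw [smul_mul_smul_comm, smul_mul_smul_comm, h, mul_comm, smul_neg]

theorem chiralityOfBasis_mul_toEnd (he : IsOrthonormalBasis g e) (l : Fin (2 * n)) :
    chiralityOfBasis γ e * γ.toEnd x (e l) = -(γ.toEnd x (e l) * chiralityOfBasis γ e) := by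
  have h := mul_prod_ofFn_of_anticommute _ _ (gammaUp_anticommute γ he) l
  rw [Odd.neg_one_pow ⟨n, rfl⟩, smul_mul_assoc, mul_smul_comm, neg_one_mul, ← smul_neg] at h
  have hc : ((g.val x (e l) (e l) : ℝ) : ℂ) ≠ 0 := by rcases he.2 l with h | h <;> simp [h]
  have h := smul_right_injective _ hc h
  rw [chiralityOfBasis, smul_mul_assoc, mul_smul_comm]
  exact (neg_eq_iff_eq_neg.2 (by rw [← smul_neg]; exact congrArg _ h)).symm

/-- Reordering contributes (-1)^(n(2n-1)) and the squares -g(e_i, e_i) contribute (-1)^t, in total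
(-1)^(n+t). The factor i is present exactly when n + t is odd. -/
theorem chiralityOfBasis_mul_self (he : IsOrthonormalBasis g e) :
    chiralityOfBasis γ e * chiralityOfBasis γ e = 1 := by
  classical
  have h := prod_ofFn_mul_self_of_anticommute _ _ (fun i ↦ ((-g.val x (e i) (e i) : ℝ) : ℂ))
    (gammaUp_anticommute γ he) (fun i ↦ by
      rw [smul_mul_smul_comm, toEnd_mul_self, smul_smul]
      rcases he.2 i with h | h <;> simp [h])
  set t := Nat.card {i // g.val x (e i) (e i) = -1} with ht
  have hprod : ∏ i, ((-g.val x (e i) (e i) : ℝ) : ℂ) = (-1) ^ t := by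
    have h1 (i) : ((-g.val x (e i) (e i) : ℝ) : ℂ)
        = (-1) * (if g.val x (e i) (e i) = -1 then -1 else 1) := by
      rcases he.2 i with h | h <;> simp [h]
      norm_num
    rw [Finset.prod_congr rfl fun i _ ↦ h1 i, Finset.prod_mul_distrib, Finset.prod_ite]
    rw [ht, Nat.card_eq_fintype_card, Fintype.card_subtype]
    simp
  rw [hprod, Nat.choose_two_right, show 2 * n * (2 * n - 1) / 2 = n * (2 * n - 1) by
    rw [mul_assoc, Nat.mul_div_cancel_left _ two_pos], ← pow_add] at h
  rw [chiralityOfBasis, smul_mul_smul_comm, h, smul_smul]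
  have hpar : Even (n * (2 * n - 1) + t) ↔ Even (n + t) := by
    -- The case n = 0 is separate because 2n - 1 is truncated there and not odd.
    rcases n with _ | n
    · simp
    · rw [Nat.even_add, Nat.even_add, Nat.even_mul]
      have : ¬ Even (2 * (n + 1) - 1) := by
        rw [Nat.not_even_iff_odd]; exact ⟨n, by omega⟩
      simp [this]
  have hdiv : ((4 : ℤ) ∣ 2 * (n : ℤ) - 2 * (t : ℤ)) ↔ Even (n + t) := by
    rw [Nat.even_iff]; omega
  by_cases hc : Even (n + t)
  · rw [if_pos (hdiv.2 hc), (hpar.2 hc).neg_one_pow]; simp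
  · rw [if_neg (mt hdiv.1 hc), (Nat.not_even_iff_odd.1 (mt hpar.1 hc)).neg_one_pow]; simp

end Basis

/-- The charge conjugation in a point as a complex bilinear form. -/
noncomputable def ChargeConjugation.toBilin {γ : CliffordMultiplication F S n g} (C : ChargeConjugation γ)
    (x : M) : S x →ₗ[ℂ] S x →ₗ[ℂ] ℂ :=
  LinearMap.mk₂ ℂ (fun φ ψ ↦ C.val x φ ψ) (by simp) (C.smul_left x) (by simp) (C.smul_right x)

theorem chargeSum_eq_twistForm {γ : CliffordMultiplication F S n g} (C : ChargeConjugation γ)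
    (k : Fin 4) (φ ψ : S x × S x) :
    chargeSum C k x φ ψ = twistForm (C.toBilin x) (tau k) φ ψ := rfl

theorem toBilin_separatingRight {γ : CliffordMultiplication F S n g} (C : ChargeConjugation γ)
    (ψ : S x) (h : ∀ φ, C.toBilin x φ ψ = 0) : ψ = 0 := by
  refine C.nondegenerate x ψ fun φ ↦ ?_
  rw [C.symm_zero]
  exact mul_eq_zero_of_right _ (h φ)

end Fibre

/-! ### Extension of vectors to differentiable sections -/

section Conjugate

variable {E : Type*} [NormedAddCommGroup E] [NormedSpace ℝ E] [FiniteDimensional ℝ E]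
  {M : Type*} [TopologicalSpace M] [ChartedSpace E M] [IsManifold 𝓘(ℝ, E) ∞ M]
  {F : Type*} [NormedAddCommGroup F] [NormedSpace ℂ F] [FiniteDimensional ℂ F]
  {S : M → Type*} [TopologicalSpace (TotalSpace F S)]
  [∀ x, AddCommGroup (S x)] [∀ x, Module ℂ (S x)] [∀ x, TopologicalSpace (S x)]
  [∀ x, IsTopologicalAddGroup (S x)] [∀ x, ContinuousSMul ℝ (S x)]
  [FiberBundle F S] [VectorBundle ℝ F S] [ContMDiffVectorBundle ∞ F S 𝓘(ℝ, E)]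
  {n : ℕ} {g : PseudoRiemannianMetric E M} {γ : CliffordMultiplication F S n g} {x : M}

theorem exists_section {G : Type*} [NormedAddCommGroup G] [NormedSpace ℝ G]
    {V : M → Type*} [TopologicalSpace (TotalSpace G V)] [∀ x, AddCommGroup (V x)]
    [∀ x, Module ℝ (V x)] [∀ x, TopologicalSpace (V x)] [FiberBundle G V] [VectorBundle ℝ G V]
    [FiniteDimensional ℝ G] [ContMDiffVectorBundle ∞ G V 𝓘(ℝ, E)]
    (v : V x) : ∃ σ : Π x : M, V x, SectionDiffAt E G σ x ∧ σ x = v := by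
  have : ContMDiffVectorBundle 1 G V 𝓘(ℝ, E) := .of_le (n := ∞) (by norm_num)
  exact ⟨FiberBundle.extend G v, FiberBundle.mdifferentiableAt_extend .., by simp⟩

end Conjugate

section TwistForm

variable {V : Type*} [AddCommGroup V] [Module ℂ V] (b : V →ₗ[ℂ] V →ₗ[ℂ] ℂ)
  (m : Matrix (Fin 2) (Fin 2) ℂ)

theorem twistForm_add_left (φ φ' ψ : V × V) :
    twistForm b m (φ + φ') ψ = twistForm b m φ ψ + twistForm b m φ' ψ := by
  simp [twistForm]; ring

theorem twistForm_add_right (φ ψ ψ' : V × V) :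
    twistForm b m φ (ψ + ψ') = twistForm b m φ ψ + twistForm b m φ ψ' := by
  simp [twistForm]; ring

theorem twistForm_neg_right (φ ψ : V × V) :
    twistForm b m φ (-ψ) = -twistForm b m φ ψ := by
  simp [twistForm]; ring

theorem twistForm_smul_right (c : ℂ) (φ ψ : V × V) :
    twistForm b m φ (c • ψ) = c * twistForm b m φ ψ := by
  simp [twistForm]; ring

theorem twistForm_smul_left (c : ℂ) (φ ψ : V × V) :
    twistForm b m (c • φ) ψ = c * twistForm b m φ ψ := by
  simp [twistForm]; ring

theorem twist_mul_twist (f h : Module.End ℂ V) (p q : Matrix (Fin 2) (Fin 2) ℂ) (ψ : V × V) :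
    twist f p (twist h q ψ) = twist (f * h) (p * q) ψ := by
  ext <;> simp [Matrix.mul_apply] <;> module

end TwistForm

/-! ### Conjugate connections and differentiability of sections -/

variable {E : Type*} [NormedAddCommGroup E] [NormedSpace ℝ E] [FiniteDimensional ℝ E]
  {M : Type*} [TopologicalSpace M] [ChartedSpace E M] [IsManifold 𝓘(ℝ, E) ∞ M]
  {F : Type*} [NormedAddCommGroup F] [NormedSpace ℂ F] [FiniteDimensional ℂ F]
  {S : M → Type*} [TopologicalSpace (TotalSpace F S)]
  [∀ x, AddCommGroup (S x)] [∀ x, Module ℂ (S x)] [∀ x, TopologicalSpace (S x)]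
  [∀ x, IsTopologicalAddGroup (S x)] [∀ x, ContinuousSMul ℝ (S x)]
  [FiberBundle F S] [VectorBundle ℝ F S] [ContMDiffVectorBundle ∞ F S 𝓘(ℝ, E)]
  {n : ℕ} {g : PseudoRiemannianMetric E M} {γ : CliffordMultiplication F S n g} {x : M}

/-- The negative adjoint, with respect to `C ⊗ τ_k`, of `(f ⊗ 1) (1 ⊗ τ_i + w G ⊗ τ_j)`. -/
theorem eq_negative_adjoint {V : Type*} [AddCommGroup V] [Module ℂ V] (b : V →ₗ[ℂ] V →ₗ[ℂ] ℂ)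
    (hr : ∀ ψ, (∀ φ, b φ ψ = 0) → ψ = 0) (adj : Module.End ℂ V →ₗ[ℂ] Module.End ℂ V)
    (hadj : ∀ f φ ψ, b (f φ) ψ = b φ (adj f ψ)) (k i j : Fin 4) (w εi εj : ℂ)
    (hi : (tau i).transpose * tau k = εi • (tau k * tau i))
    (hj : (tau j).transpose * tau k = εj • (tau k * tau j)) (f G : Module.End ℂ V) (ψ χ : V × V)
    (h : ∀ φ, twistForm b (tau k) (twist f 1 (twist 1 (tau i) φ + w • twist G (tau j) φ)) ψ
      + twistForm b (tau k) φ χ = 0) :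
    χ = -(εi • twist (adj f) (tau i) ψ + (w * εj) • twist (adj (f * G)) (tau j) ψ) := by
  rw [eq_neg_iff_add_eq_zero]
  refine twistForm_separatingRight b hr k _ fun φ ↦ ?_
  rw [← h φ, map_add, map_smul, twist_mul_twist, twist_mul_twist, mul_one, one_mul, one_mul,
    twistForm_add_left, twistForm_smul_left, twistForm_twist_left b adj hadj _ _ εi hi,
    twistForm_twist_left b adj hadj _ _ εj hj, twistForm_add_right, twistForm_add_right,
    mul_smul, twistForm_smul_right _ _ w]
  ring

/-- The derivative term cancels between the two defining equations, leaving the adjoint of A. The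
adjoint and the signs are chosen before D, so that one formula serves both ∇ and D - A. -/
theorem exists_conjugate_sub (C : ChargeConjugation γ)
    (hf : FiniteDimensional ℂ (S x)) (γs : Π x : M, Module.End ℂ (S x)) (k i j : Fin 4) (w : ℤˣ) :
    ∃ (adj : Module.End ℂ (S x) →ₗ[ℂ] Module.End ℂ (S x)) (εi εj : ℂ), εi * εi = 1 ∧
      (i = j → εi = εj) ∧
      ∀ (A : Π x : M, (S ×ᵇ S) x →L[ℝ] TangentSpace 𝓘(ℝ, E) x →L[ℝ] (S ×ᵇ S) x)
        (B : TangentSpace 𝓘(ℝ, E) x →ₗ[ℝ] Module.End ℂ (S x))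
        (_ : ∀ (v : TangentSpace 𝓘(ℝ, E) x) (ψ : S x × S x),
          A x ψ v = twist (B v) 1 (chiralProjection γs i j w x ψ))
        (D DC DC' : SumConnection E F S) (_ : IsConjugateConnection C k D DC)
        (_ : IsConjugateConnection C k (D.addOneForm A) DC')
        (ψ : Π x : M, (S ×ᵇ S) x) (_ : SectionDiffAt E (F × F) (V := S ×ᵇ S) ψ x)
        (v : TangentSpace 𝓘(ℝ, E) x),
        (DC' ψ x v : S x × S x) - (DC ψ x v : S x × S x)
          = -(εi • twist (adj (B v)) (tau i) (ψ x)
            + (((w : ℤ) : ℂ) * εj) • twist (adj (B v * γs x)) (tau j) (ψ x)) := by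
  obtain ⟨adj, hadj⟩ := exists_adjoint (C.toBilin x) (toBilin_separatingRight C)
  choose ε hε hτ using exists_tau_sign k
  refine ⟨adj, ε i, ε j, hε i, fun h ↦ by rw [h], fun A B hB D DC DC' h h' ψ hψ v ↦ ?_⟩
  refine eq_negative_adjoint (C.toBilin x) (toBilin_separatingRight C) adj hadj k i j _ _ _
    (hτ i) (hτ j) (B v) (γs x) _ _ fun φ₀ ↦ ?_
  obtain ⟨φ, hφ, rfl⟩ := exists_section (E := E) (G := F × F) (V := S ×ᵇ S) (x := x) φ₀
  have h1 := h x φ ψ hφ hψ v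
  have h2 := h' x φ ψ hφ hψ v
  rw [h1] at h2
  have h3 : (D.addOneForm A) φ x v = (D φ x v : S x × S x)
    + twist (B v) 1 (chiralProjection γs i j w x (φ x)) := by
    rw [← hB]; rfl
  rw [h3] at h2
  simp only [chargeSum_eq_twistForm, twistForm_add_left] at h2
  rw [sub_eq_add_neg, twistForm_add_right, twistForm_neg_right]
  change twistForm _ _ (twist (B v) 1 (chiralProjection γs i j w x (φ x))) _ + _ = 0
  linear_combination -h2

theorem SectionDiffAt.clifford (γ : CliffordMultiplication F S n g)
    {Y : Π x : M, TangentSpace 𝓘(ℝ, E) x} {ψ : Π x : M, S x}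
    (hY : SectionDiffAt E E Y x) (hψ : SectionDiffAt E F ψ x) :
    SectionDiffAt E F (fun p ↦ γ.val p (Y p) (ψ p)) x :=
  (γ.contMDiff.mdifferentiable (by simp) x).clm_bundle_apply₂ hY hψ

theorem mdifferentiableAt_charge (C : ChargeConjugation γ) {φ ψ : Π x : M, S x}
    (hφ : SectionDiffAt E F φ x) (hψ : SectionDiffAt E F ψ x) :
    MDifferentiableAt 𝓘(ℝ, E) 𝓘(ℝ, ℂ) (fun p ↦ C.val p (φ p) (ψ p)) x := by
  have h := (C.contMDiff.mdifferentiable (by simp) x).clm_bundle_apply₂ (F₁ := F) (F₂ := F)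
    (F₃ := ℂ) (E₃ := Trivial M ℂ) hφ hψ
  simpa [mdifferentiableAt_section] using h

/-- Here the trivializations must be ℂ-linear on fibres, so that c acts as a fixed linear map on F.
-/
theorem SectionDiffAt.complex_smul {ψ : Π x : M, S x} (c : ℂ)
    [VectorBundle ℂ F S]
    (hψ : SectionDiffAt E F ψ x) : SectionDiffAt E F (c • ψ) x := by
  unfold SectionDiffAt at *
  rw [mdifferentiableAt_section] at *
  have h1 : MDifferentiableAt 𝓘(ℝ, E) 𝓘(ℝ, F)
    (fun p ↦ c • (trivializationAt F S x ⟨p, ψ p⟩).2) x :=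
    (((c • ContinuousLinearMap.id ℂ F).restrictScalars ℝ).differentiableAt.mdifferentiableAt).comp
      x hψ
  refine h1.congr_of_eventuallyEq ?_
  filter_upwards [(trivializationAt F S x).open_baseSet.mem_nhds
    (FiberBundle.mem_baseSet_trivializationAt' x)] with p hp
  exact ((trivializationAt F S x).linear ℂ hp).2 c (ψ p)

end SpinTorsion

/-! ### The Levi-Civita connection on S ⊕ S as reference -/

namespace SpinTorsion

variable {E : Type*} [NormedAddCommGroup E] [NormedSpace ℝ E] [FiniteDimensional ℝ E]
  {M : Type*} [TopologicalSpace M] [ChartedSpace E M] [IsManifold 𝓘(ℝ, E) ∞ M]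
  {F : Type*} [NormedAddCommGroup F] [NormedSpace ℂ F] [FiniteDimensional ℂ F]
  {S : M → Type*} [TopologicalSpace (TotalSpace F S)]
  [∀ x, AddCommGroup (S x)] [∀ x, Module ℂ (S x)] [∀ x, TopologicalSpace (S x)]
  [∀ x, IsTopologicalAddGroup (S x)] [∀ x, ContinuousSMul ℝ (S x)]
  [FiberBundle F S] [VectorBundle ℂ F S] [VectorBundle ℝ F S]
  [ContMDiffVectorBundle ∞ F S 𝓘(ℝ, E)]
  {n : ℕ} {g : PseudoRiemannianMetric E M} {γ : CliffordMultiplication F S n g}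
  {C : ChargeConjugation γ}
  {nabla : CovariantDerivative 𝓘(ℝ, E) E (TangentSpace 𝓘(ℝ, E) : M → Type _)}
  {nablaS : CovariantDerivative 𝓘(ℝ, E) F S}

/-- The entries of τ_k are constants and ∇ is complex linear, so C ⊗ τ_k inherits parallelism from
C. -/
theorem sumConnection_isConjugateConnection (h : IsSpinLeviCivita C nabla nablaS) (k : Fin 4) :
    IsConjugateConnection C k (sumConnection (F := F) nablaS)
      (sumConnection (F := F) nablaS) := by
  intro x φ ψ hφ hψ v
  obtain ⟨hφ1, hφ2⟩ := (sectionDiffAt_pair_iff φ x).1 hφ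
  obtain ⟨hψ1, hψ2⟩ := (sectionDiffAt_pair_iff ψ x).1 hψ
  have hlin (a b : ℂ) : SectionDiffAt E F (a • (fun p ↦ (ψ p).1) + b • (fun p ↦ (ψ p).2)) x ∧
      nablaS (a • (fun p ↦ (ψ p).1) + b • (fun p ↦ (ψ p).2)) x v
        = a • nablaS (fun p ↦ (ψ p).1) x v + b • nablaS (fun p ↦ (ψ p).2) x v := by
    have h1 := hψ1.complex_smul a
    have h2 := hψ2.complex_smul b
    refine ⟨mdifferentiableAt_add_section h1 h2, ?_⟩
    rw [nablaS.isCovariantDerivativeOnUniv.add h1 h2, add_apply,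
      h.complex_linear x _ hψ1, h.complex_linear x _ hψ2]
  obtain ⟨d1, e1⟩ := hlin (tau k 0 0) (tau k 0 1)
  obtain ⟨d2, e2⟩ := hlin (tau k 1 0) (tau k 1 1)
  have key := mvfderiv_fun_add (mdifferentiableAt_charge C hφ1 d1)
    (mdifferentiableAt_charge C hφ2 d2)
  have key := congrArg (fun L ↦ L v) key
  rw [add_apply, h.charge_parallel x _ _ hφ1 d1 v,
    h.charge_parallel x _ _ hφ2 d2 v, e1, e2] at key
  refine Eq.trans key ?_
  change _ = (C.val x (nablaS (fun p ↦ (φ p).1) x v) (tau k 0 0 • (ψ x).1 + tau k 0 1 • (ψ x).2)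
    + C.val x (nablaS (fun p ↦ (φ p).2) x v) (tau k 1 0 • (ψ x).1 + tau k 1 1 • (ψ x).2))
    + (C.val x (φ x).1 (tau k 0 0 • nablaS (fun p ↦ (ψ p).1) x v
        + tau k 0 1 • nablaS (fun p ↦ (ψ p).2) x v)
      + C.val x (φ x).2 (tau k 1 0 • nablaS (fun p ↦ (ψ p).1) x v
        + tau k 1 1 • nablaS (fun p ↦ (ψ p).2) x v))
  simp only [Pi.add_apply, Pi.smul_apply]
  ring

theorem cliffordSum_apply (v : TangentSpace 𝓘(ℝ, E) x) (ψ : S x × S x) :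
    cliffordSum γ x v ψ = (γ.val x v ψ.1, γ.val x v ψ.2) := by
  simp [cliffordSum]
  exact ⟨rfl, rfl⟩

theorem SectionDiffAt.cliffordSum (γ : CliffordMultiplication F S n g)
    {Y : Π x : M, TangentSpace 𝓘(ℝ, E) x}
    {ψ : Π x : M, (S ×ᵇ S) x} (hY : SectionDiffAt E E Y x)
    (hψ : SectionDiffAt E (F × F) (V := S ×ᵇ S) ψ x) :
    SectionDiffAt E (F × F) (V := S ×ᵇ S) (fun p ↦ cliffordSum γ p (Y p) (ψ p)) x := by
  obtain ⟨h1, h2⟩ := (sectionDiffAt_pair_iff ψ x).1 hψ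
  simp only [cliffordSum_apply]
  exact (sectionDiffAt_pair_iff _ x).2 ⟨hY.clifford γ h1, hY.clifford γ h2⟩

theorem sumConnection_clifford_parallel (h : IsSpinLeviCivita C nabla nablaS)
    {Y : Π x : M, TangentSpace 𝓘(ℝ, E) x}
    {ψ : Π x : M, (S ×ᵇ S) x} (hY : SectionDiffAt E E Y x)
    (hψ : SectionDiffAt E (F × F) (V := S ×ᵇ S) ψ x) (v : TangentSpace 𝓘(ℝ, E) x) :
    (sumConnection (F := F) nablaS (fun p ↦ cliffordSum γ p (Y p) (ψ p)) x v)
      = cliffordSum γ x (nabla Y x v) (ψ x)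
        + cliffordSum γ x (Y x) (sumConnection (F := F) nablaS ψ x v) := by
  obtain ⟨h1, h2⟩ := (sectionDiffAt_pair_iff ψ x).1 hψ
  simp only [cliffordSum_apply]
  exact Prod.ext (h.clifford_parallel x Y _ hY h1 v) (h.clifford_parallel x Y _ hY h2 v)

/-- The contribution of a one-form to `D̂γ`. -/
theorem hatD_addOneForm_sub (γ : CliffordMultiplication F S n g)
    (A : Π x : M, (S ×ᵇ S) x →L[ℝ] TangentSpace 𝓘(ℝ, E) x →L[ℝ] (S ×ᵇ S) x)
    (D DC DC' : SumConnection E F S) (X Y : Π x : M, TangentSpace 𝓘(ℝ, E) x)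
    (ξ : Π x : M, (S ×ᵇ S) x) (x : M) :
    hatD γ nabla (D.addOneForm A) DC' X Y ξ x - hatD γ nabla D DC X Y ξ x
      = (A x (cliffordSum γ x (Y x) (ξ x)) (X x) : S x × S x)
        - cliffordSum γ x (Y x) ((DC' ξ x (X x) : S x × S x) - DC ξ x (X x)) := by
  have h : ((D.addOneForm A) (fun p ↦ cliffordSum γ p (Y p) (ξ p)) x (X x))
      = (D (fun p ↦ cliffordSum γ p (Y p) (ξ p)) x (X x) : S x × S x)
        + (A x (cliffordSum γ x (Y x) (ξ x)) (X x) : S x × S x) := rfl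
  unfold hatD
  rw [map_sub]
  erw [h]
  abel

theorem hatD_sumConnection (h : IsSpinLeviCivita C nabla nablaS)
    {X Y : Π x : M, TangentSpace 𝓘(ℝ, E) x}
    {ξ : Π x : M, (S ×ᵇ S) x} (hY : SectionDiffAt E E Y x)
    (hξ : SectionDiffAt E (F × F) (V := S ×ᵇ S) ξ x) :
    hatD γ nabla (sumConnection (F := F) nablaS) (sumConnection (F := F) nablaS) X Y ξ x = 0 := by
  unfold hatD
  erw [sumConnection_clifford_parallel h hY hξ (X x)]
  abel

theorem chiralProjection_neg (γs : Π x : M, Module.End ℂ (S x)) (i j : Fin 4) (w : ℤˣ) (x : M)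
    (ψ : S x × S x) : chiralProjection γs i j (-w) x ψ
      = twist 1 (tau i) ψ - ((w : ℤ) : ℂ) • twist (γs x) (tau j) ψ := by
  simp [chiralProjection, sub_eq_add_neg]

end SpinTorsion

/-! ### The proposition -/

open SpinTorsion

theorem proposition4p13
    {E : Type*} [NormedAddCommGroup E] [NormedSpace ℝ E] [FiniteDimensional ℝ E]
    {M : Type*} [TopologicalSpace M] [T2Space M] [ChartedSpace E M] [IsManifold 𝓘(ℝ, E) ∞ M]
    {F : Type*} [NormedAddCommGroup F] [NormedSpace ℂ F] [FiniteDimensional ℂ F]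
    {S : M → Type*} [TopologicalSpace (TotalSpace F S)]
    [∀ x, AddCommGroup (S x)] [∀ x, Module ℂ (S x)] [∀ x, TopologicalSpace (S x)]
    [∀ x, IsTopologicalAddGroup (S x)] [∀ x, ContinuousSMul ℝ (S x)]
    [FiberBundle F S] [VectorBundle ℂ F S] [VectorBundle ℝ F S]
    [ContMDiffVectorBundle ∞ F S 𝓘(ℝ, E)]
    (n : ℕ) (hn : Module.finrank ℝ E = 2 * n)
    (g : SpinTorsion.PseudoRiemannianMetric E M)
    (γ : SpinTorsion.CliffordMultiplication F S n g)
    (γs : Π x : M, Module.End ℂ (S x)) (hγs : SpinTorsion.IsChiralityOperator γ γs)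
    (C : SpinTorsion.ChargeConjugation γ)
    (nabla : CovariantDerivative 𝓘(ℝ, E) E (TangentSpace 𝓘(ℝ, E) : M → Type _))
    (hnabla : SpinTorsion.IsLeviCivita g nabla)
    (nablaS : CovariantDerivative 𝓘(ℝ, E) F S)
    (hnablaS : SpinTorsion.IsSpinLeviCivita C nabla nablaS)
    -- the charge conjugation `C ⊗ τ_k` and the operator `1 ⊗ τ_i + w γ* ⊗ τ_j`
    (k i j : Fin 4) (w : ℤˣ)
    -- an admissible contribution proportional to the operator
    (A : Π x : M, (S ×ᵇ S) x →L[ℝ] TangentSpace 𝓘(ℝ, E) x →L[ℝ] (S ×ᵇ S) x)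
    (hA : SpinTorsion.IsProportionalOneForm A (SpinTorsion.chiralProjection γs i j w))
    (hadm : SpinTorsion.IsAdmissible C k nabla
      ((SpinTorsion.sumConnection (F := F) nablaS).addOneForm A))
    -- the connection `D`, and the connection `D - A` without the contribution
    (D DC D₀C : SpinTorsion.SumConnection E F S)
    (hD : SpinTorsion.IsComplexLinear D)
    (hDC : SpinTorsion.IsConjugateConnection C k D DC)
    (hD₀C : SpinTorsion.IsConjugateConnection C k (D.addOneForm (fun x ↦ -A x)) D₀C) :
    SpinTorsion.IsProportionalOneForm (DC.difference D₀C)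
        (SpinTorsion.chiralProjection γs i j (-w)) ∧
      SpinTorsion.IsProportionalTwoForm (F := F)
        (fun X Y ξ ↦ SpinTorsion.spinTorsion γ nabla D DC X Y ξ
          - SpinTorsion.spinTorsion γ nabla (D.addOneForm (fun x ↦ -A x)) D₀C X Y ξ)
        (SpinTorsion.chiralProjection γs i j (-w)) := by
  have hw : ((w : ℤ) : ℂ) * ((w : ℤ) : ℂ) = 1 := by
    rcases Int.units_eq_one_or w with rfl | rfl <;> simp
  obtain ⟨B, hB⟩ := hA
  obtain ⟨D'C, hD'C, hskew⟩ := hadm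
  have hanti : ∀ (x : M) (v : TangentSpace 𝓘(ℝ, E) x),
      γs x * γ.toEnd x v = -(γ.toEnd x v * γs x) := by
    intro x v
    obtain ⟨e, he, hγ⟩ := hγs.eq_chiralityOfBasis x
    rw [hγ, eq_neg_iff_add_eq_zero]
    -- The anticommutator is linear in v, so the basis that computes γ* at x suffices.
    have := e.ext (f₁ := (LinearMap.mulLeft ℝ (chiralityOfBasis γ e)
      + LinearMap.mulRight ℝ (chiralityOfBasis γ e)) ∘ₗ γ.toEndₗ x) (f₂ := 0) fun l ↦
        eq_neg_iff_add_eq_zero.1 (chiralityOfBasis_mul_toEnd γ he l)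
    exact LinearMap.congr_fun this v
  have hDA : D = (D.addOneForm (fun x ↦ -A x)).addOneForm A := by
    ext σ x v : 4
    simp [CovariantDerivative.addOneForm]
  have key : ∀ x : M, ∃ B' : TangentSpace 𝓘(ℝ, E) x →ₗ[ℝ] Module.End ℂ (S x),
      (∀ (ψ : Π x : M, (S ×ᵇ S) x), SectionDiffAt E (F × F) (V := S ×ᵇ S) ψ x →
        ∀ v : TangentSpace 𝓘(ℝ, E) x, (DC ψ x v : S x × S x) - (D₀C ψ x v : S x × S x)
          = twist (B' v) 1 (chiralProjection γs i j (-w) x (ψ x))) ∧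
      (∀ (v u : TangentSpace 𝓘(ℝ, E) x) (ψ : S x × S x),
        (A x (cliffordSum γ x u ψ) v : S x × S x)
          - cliffordSum γ x u (twist (B' v) 1 (chiralProjection γs i j (-w) x ψ))
        = -((A x (cliffordSum γ x v ψ) u : S x × S x)
          - cliffordSum γ x v (twist (B' u) 1 (chiralProjection γs i j (-w) x ψ)))) := by
    intro x
    obtain ⟨e, he, hγ⟩ := hγs.eq_chiralityOfBasis x
    obtain ⟨adj, εi, εj, hεi, hij, hadj⟩ := exists_conjugate_sub (x := x) C
      (VectorBundle.finiteDimensional ℂ F S x) γs k i j w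
    -- Admissibility of ∇ + A in tensorial form: vectors are extended to sections and the part
    -- coming from ∇ vanishes.
    have hskew' : ∀ (v u : TangentSpace 𝓘(ℝ, E) x) (ψ : S x × S x),
        (A x (cliffordSum γ x u ψ) v : S x × S x)
          - cliffordSum γ x u (-(εi • twist (adj (B x v)) (tau i) ψ
            + (((w : ℤ) : ℂ) * εj) • twist (adj (B x v * γs x)) (tau j) ψ))
        = -((A x (cliffordSum γ x v ψ) u : S x × S x)
          - cliffordSum γ x v (-(εi • twist (adj (B x u)) (tau i) ψ
            + (((w : ℤ) : ℂ) * εj) • twist (adj (B x u * γs x)) (tau j) ψ))) := by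
      intro v u ψ
      obtain ⟨X, hX, rfl⟩ := exists_section (E := E) (G := E)
        (V := (TangentSpace 𝓘(ℝ, E) : M → Type _)) (x := x) v
      obtain ⟨Y, hY, rfl⟩ := exists_section (E := E) (G := E)
        (V := (TangentSpace 𝓘(ℝ, E) : M → Type _)) (x := x) u
      obtain ⟨ξ, hξ, rfl⟩ := exists_section (E := E) (G := F × F) (V := S ×ᵇ S) (x := x) ψ
      have hconj := sumConnection_isConjugateConnection hnablaS k
      have h := hskew x X Y ξ hX hY hξ
      have h1 := hatD_addOneForm_sub (nabla := nabla) γ A (sumConnection (F := F) nablaS)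
        (sumConnection (F := F) nablaS) D'C X Y ξ x
      have h2 := hatD_addOneForm_sub (nabla := nabla) γ A (sumConnection (F := F) nablaS)
        (sumConnection (F := F) nablaS) D'C Y X ξ x
      rw [hatD_sumConnection hnablaS hY hξ, sub_zero,
        hadj A (B x) (hB x) _ _ _ hconj hD'C ξ hξ] at h1
      rw [hatD_sumConnection hnablaS hX hξ, sub_zero,
        hadj A (B x) (hB x) _ _ _ hconj hD'C ξ hξ] at h2
      rw [h1, h2] at h
      exact h
    obtain ⟨B', hB'⟩ := exists_opposite_proportional e adj (γ.toEnd x) (γs x)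
      (by rw [hγ]; exact chiralityOfBasis_mul_self γ he)
      (toEnd_mul_cancel γ he) (fun l ↦ hanti x (e l)) (B x) i j _ hw εi εj hεi hij
      -- On the diagonal v = u = e_l, skewness reads a = -a, hence a = 0.
      (fun l ψ ↦ by
        have h := hskew' (e l) (e l) ψ
        have half (a : S x × S x) (ha : a = -a) : a = 0 := by
          have h2 : (2 : ℂ) • a = 0 := by rw [two_smul]; exact eq_neg_iff_add_eq_zero.1 ha
          simpa using h2
        have h := sub_eq_zero.1 (half _ h)
        rw [hB] at h
        exact h)
    simp only [← chiralProjection_neg] at hB'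
    refine ⟨B', fun ψ hψ v ↦ ?_, fun v u ψ ↦ ?_⟩
    · rw [← hB']
      -- The same formula, now with D - A as base connection in place of ∇.
      exact hadj A (B x) (hB x) _ _ _ hD₀C (hDA ▸ hDC) ψ hψ v
    · rw [← hB', ← hB']
      exact hskew' v u ψ
  choose B' hB' hsk using key
  refine ⟨⟨B', fun x v ψ ↦ ?_⟩, ?_⟩
  · obtain ⟨σ, hσ, rfl⟩ := exists_section (E := E) (G := F × F) (V := S ×ᵇ S) (x := x) ψ
    rw [← hB' x σ hσ]
    have h := DC.isCovariantDerivativeOnUniv.difference_apply D₀C.isCovariantDerivativeOnUniv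
      (x := x) (by trivial) hσ
    exact congrArg (fun L ↦ L v) h
  -- Moving γ(u) to the left of P_w turns it into P_{-w}, so the contribution A_v γ(u) - γ(u) A^C_v
  -- has the coefficient B_v γ(u) - γ(u) B'_v. Its skew symmetrization is the required two-form.
  · let T (x : M) : TangentSpace 𝓘(ℝ, E) x →ₗ[ℝ] TangentSpace 𝓘(ℝ, E) x →ₗ[ℝ]
        Module.End ℂ (S x) :=
      (LinearMap.mul ℝ (Module.End ℂ (S x))).compl₁₂ (B x) (γ.toEndₗ x)
        - ((LinearMap.mul ℝ (Module.End ℂ (S x))).compl₁₂ (γ.toEndₗ x) (B' x)).flip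
    have hT (x : M) (v u : TangentSpace 𝓘(ℝ, E) x) :
      T x v u = B x v * γ.toEnd x u - γ.toEnd x u * B' x v := rfl
    refine ⟨fun x ↦ T x - (T x).flip, fun x v ↦ by simp, fun x X Y ξ hX hY hξ ↦ ?_⟩
    have hsum : ∀ (v u : TangentSpace 𝓘(ℝ, E) x) (ψ : S x × S x),
        (A x (cliffordSum γ x u ψ) v : S x × S x)
          - cliffordSum γ x u (twist (B' x v) 1 (chiralProjection γs i j (-w) x ψ))
        = twist (T x v u) 1 (chiralProjection γs i j (-w) x ψ) := by
      intro v u ψ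
      have hG (φ : S x) : γs x (γ.toEnd x u φ) = -(γ.toEnd x u (γs x φ)) :=
        LinearMap.congr_fun (hanti x u) φ
      rw [hB, hT, chiralProjection_neg]
      simp only [cliffordSum, chiralProjection]
      ext <;> simp [hG] <;> module
    have hdiff (X Y : Π x : M, TangentSpace 𝓘(ℝ, E) x) :
        hatD γ nabla D DC X Y ξ x - hatD γ nabla (D.addOneForm (fun x ↦ -A x)) D₀C X Y ξ x
          = twist (T x (X x) (Y x)) 1 (chiralProjection γs i j (-w) x (ξ x)) := by
      have h := hatD_addOneForm_sub (nabla := nabla) γ A (D.addOneForm (fun x ↦ -A x))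
        D₀C DC X Y ξ x
      rw [← hDA, hB' x ξ hξ, hsum] at h
      exact h
    have htw (f h : Module.End ℂ (S x)) (ψ : S x × S x) :
        twist (f - h) 1 ψ = twist f 1 ψ - twist h 1 ψ := by
      ext <;> simp
    change hatD γ nabla D DC X Y ξ x - hatD γ nabla D DC Y X ξ x
      - (hatD γ nabla (D.addOneForm (fun x ↦ -A x)) D₀C X Y ξ x
        - hatD γ nabla (D.addOneForm (fun x ↦ -A x)) D₀C Y X ξ x)
      = twist (T x (X x) (Y x) - T x (Y x) (X x)) 1 _
    rw [htw, ← hdiff, ← hdiff]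
    abel
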